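/- Let $m\ge 2$, let $\sigma_1\ge\dots\ge\sigma_m>0$ be real numbers with $\sigma_1+\dots+\sigma_m=1$, and let $\Theta=(\theta_{11},\dots,\theta_{1m})\in\mathbb R^{1\times m}$ with $\Theta\notin\mathbb Q^{1\times m}$. Let $\hat\omega\in[-\infty,+\infty]$ be the supremum of the real numbers $\gamma$ such that for every sufficiently large $t$ the system $$\max_{1\le j\le m}|x_j|^{1/\sigma_j}\le t,\qquad |\theta_{11}x_1+\dots+\theta_{1m}x_m-y|\le t^{-\gamma}$$ has a nonzero solution $(x_1,\dots,x_m,y)\in\mathbb Z^{m+1}$, and let ${}^t\hat\omega$ be the supremum of the real numbers $\gamma$ such that for every sufficiently large $t$ the system $$|x|\le t,\qquad \max_{1\le j\le m}|\theta_{1j}x-y_j|^{1/\sigma_j}\le t^{-\gamma}$$ has a nonzero solution $(x,y_1,\dots,y_m)\in\mathbb Z^{1+m}$. Then, with the convention $(+\infty)^{-1}=0$, $$(1-\sigma_m)\,{}^t\hat\omega+\sigma_m\hat\omega^{-1}\ge 1,\qquad \sigma_m\,{}^t\hat\omega+(1-\sigma_m)\hat\omega^{-1}\le 1.$$ Moreover,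 $\sigma_k\,{}^t\hat\omega\le 1$, where $k$ is the minimal index such that $\theta_{1k}$ is irrational. -/

import Mathlib

open scoped Matrix

noncomputable section

/-- The weighted norm `max_j |x_j|^(1 / w_j)` attached to weights `w`. -/
def weightedNorm {k : ℕ} (w x : Fin k → ℝ) : ℝ :=
  ⨆ j, |x j| ^ (1 / w j)

/-- The system `|x|_σ ≤ t`, `|Θ x - y|_ρ ≤ t^(-γ)` has a nonzero solution
`(x, y)` in integer vectors. -/
def HasNonzeroSolution {m n : ℕ} (σ : Fin m → ℝ) (ρ : Fin n → ℝ)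
    (Θ : Matrix (Fin n) (Fin m) ℝ) (γ t : ℝ) : Prop :=
  ∃ (x : Fin m → ℤ) (y : Fin n → ℤ), (x, y) ≠ 0 ∧
    weightedNorm σ (fun j => (x j : ℝ)) ≤ t ∧
    weightedNorm ρ (Θ *ᵥ (fun j => (x j : ℝ)) - fun i => (y i : ℝ)) ≤ t ^ (-γ)

/-- The uniform weighted Diophantine exponent: the supremum, in the extended reals, of the
real `γ` such that the system has a nonzero integer solution for every large enough `t`. -/
def uniformExponent {m n : ℕ} (σ : Fin m → ℝ) (ρ : Fin n → ℝ)
    (Θ : Matrix (Fin n) (Fin m) ℝ) : EReal :=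
  sSup ((fun γ : ℝ => (γ : EReal)) ''
    {γ : ℝ | ∃ T : ℝ, ∀ t : ℝ, T ≤ t → HasNonzeroSolution σ ρ Θ γ t})

end

/-! The points `(z₀ + ∑ θ_j z_j, z)` and `(w₀, w - θ w₀)` form dual unimodular lattices, so their
pairing is integral. To find a dual point in a box `B`, take primal points orthogonal to it. A
single primal point `f` replaces one coordinate form in Minkowski's theorem: the form `f` takes an
integer value of modulus below 1, hence 0, and the discarded coordinate is recovered from
orthogonality. Two independent points `f`, `g` replace two coordinates in the same way, the 2×2
minors of `(f, g)` playing the role of the coordinates of `f`.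

Both transference inequalities follow this pattern. Fix a box of lattice points suggested by the
hypothesis at one scale, and take an (almost) minimal point of it. If that point is very small, it
suffices alone. Otherwise the hypothesis at a scale matched to its size yields a second, smaller
point, which must therefore leave the box; this makes the two independent and bounds their minors.
The exponent conditions are tightest at the least weight, whence `σm` in the result
(`eventually_dualSol_of_primalSol`, `eventually_primalSol_of_dualSol`).

The bound with an irrational `θ k` is the classical one-number argument: approximations at
successive doubled scales that are too good must all be the same fraction (`mul_le_one_of_dualSol`).
Finally `transference_sSup` passes to suprema. -/

/-! ### Geometry of numbers: Minkowski's theorem and orthogonality to integral forms. -/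

-- Minkowski's convex body theorem for the lattice `ℤ^ι` and the parallelepiped that `A` maps onto
-- the box, of volume `2^n ∏ c i / |det A|`.
open MeasureTheory in
theorem exists_int_forms_lt {ι : Type*} [Fintype ι] [DecidableEq ι] (A : Matrix ι ι ℝ)
    (hA : A.det ≠ 0) (c : ι → ℝ) (hc : ∀ i, 0 < c i) (hdet : |A.det| < ∏ i, c i) :
    ∃ w : ι → ℤ, w ≠ 0 ∧ ∀ i, |(A *ᵥ fun j => (w j : ℝ)) i| < c i := by
  let b := Pi.basisFun ℝ ι
  let S : Set (ι → ℝ) := Set.univ.pi fun i => Set.Ioo (-c i) (c i)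
  have hS : Convex ℝ S := convex_pi fun i _ => convex_Ioo _ _
  have hvol : volume (Matrix.toLin' A ⁻¹' S)
      = ENNReal.ofReal |A.det|⁻¹ * ∏ i, ENNReal.ofReal (2 * c i) := by
    rw [Measure.addHaar_preimage_linearMap volume (by simpa using hA), LinearMap.det_toLin',
      abs_inv, Real.volume_pi_Ioo]
    congr 2
    ext i
    ring_nf
  have : Countable (Submodule.span ℤ (Set.range b)).toAddSubgroup := by
    change Countable (Submodule.span ℤ (Set.range b))
    infer_instance
  have h := exists_ne_zero_mem_lattice_of_measure_mul_two_pow_lt_measure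
    (μ := volume) (L := (Submodule.span ℤ (Set.range b)).toAddSubgroup)
    (F := ZSpan.fundamentalDomain b) (s := Matrix.toLin' A ⁻¹' S)
    (ZSpan.isAddFundamentalDomain b volume)
    (by
      intro x hx
      simp only [Set.mem_preimage, map_neg, S, Set.mem_pi, Set.mem_Ioo, Set.mem_univ,
        Pi.neg_apply, true_imp_iff] at hx ⊢
      exact fun i => ⟨by linarith [(hx i).2], by linarith [(hx i).1]⟩)
    (hS.linear_preimage _)
    (by
      have h1 : volume (ZSpan.fundamentalDomain b) = 1 := by
        have : Matrix.of (Pi.basisFun ℝ ι) = 1 := by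
          ext i j
          simp [Matrix.one_apply, Pi.single_apply, eq_comm]
        rw [ZSpan.volume_fundamentalDomain, this]
        simp
      rw [h1, hvol, one_mul, ← ENNReal.ofReal_prod_of_nonneg (fun i _ => by linarith [hc i]),
        ← ENNReal.ofReal_mul (by positivity), Finset.prod_mul_distrib]
      simp only [Module.finrank_fintype_fun_eq_card, Finset.prod_const, Finset.card_univ]
      rw [show (2 : ENNReal) ^ Fintype.card ι = ENNReal.ofReal (2 ^ Fintype.card ι) by
        rw [ENNReal.ofReal_pow (by norm_num)]; simp, ENNReal.ofReal_lt_ofReal_iff']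
      have : 0 < |A.det| := abs_pos.2 hA
      have hp : 0 < ∏ i, c i := Finset.prod_pos fun i _ => hc i
      refine ⟨?_, by positivity⟩
      have h2 : (0 : ℝ) < 2 ^ Fintype.card ι := by positivity
      have : 1 < |A.det|⁻¹ * ∏ i, c i := by
        rw [inv_mul_eq_div, one_lt_div this]; exact hdet
      nlinarith)
  obtain ⟨⟨x, hx⟩, hx0, hxS⟩ := h
  have hx' : x ∈ Submodule.span ℤ (Set.range b) := hx
  rw [b.mem_span_iff_repr_mem ℤ] at hx'
  choose w hw using hx'
  have hxw : x = fun j => (w j : ℝ) := by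
    ext j
    have := hw j
    simpa [b] using this.symm
  refine ⟨w, ?_, fun i => ?_⟩
  · rintro rfl
    exact hx0 (Subtype.ext (by simp [hxw]; rfl))
  · have := hxS
    simp only [Set.mem_preimage, S, Set.mem_pi, Set.mem_Ioo, Set.mem_univ,
      true_imp_iff, Matrix.toLin'_apply, hxw] at this
    exact abs_lt.2 (this i)

/-- The matrix is a rank-two perturbation `1 + U * V` of the identity, so `det (1 + U * V) = det (1
+ V * U)` reduces the computation to a 2×2 determinant. -/
theorem det_one_updateRow_pair {ι : Type*} [Fintype ι] [DecidableEq ι] {a b : ι} (hab : a ≠ b)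
    (f g : ι → ℝ) :
    (Matrix.of fun i => if i = a then f else if i = b then g else Pi.single i 1).det
      = f a * g b - f b * g a := by
  let U : Matrix ι (Fin 2) ℝ := (Matrix.of ![Pi.single a 1, Pi.single b 1])ᵀ
  let V : Matrix (Fin 2) ι ℝ := Matrix.of ![f - Pi.single a 1, g - Pi.single b 1]
  have : (Matrix.of fun i => if i = a then f else if i = b then g else Pi.single i 1)
      = 1 + U * V := by
    ext i j
    simp only [Matrix.of_apply, Matrix.add_apply, Matrix.mul_apply, Fin.sum_univ_two, U, V,
      Matrix.one_apply]
    rcases eq_or_ne i a with rfl | hia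
    · simp [hab, Pi.single_apply, eq_comm]
    · rcases eq_or_ne i b with rfl | hib
      · simp [hia, Pi.single_apply, eq_comm]
      · simp [hia, hib, Pi.single_apply, eq_comm]
  rw [this, Matrix.det_one_add_mul_comm, Matrix.det_fin_two]
  simp [U, V, Matrix.vecMul, dotProduct, Pi.single_apply, hab, hab.symm]

theorem det_one_updateRow_single {ι : Type*} [Fintype ι] [DecidableEq ι] (a : ι)
    (f : ι → ℝ) :
    (Matrix.of fun i => if i = a then f else Pi.single i 1).det = f a := by
  let U : Matrix ι (Fin 1) ℝ := Matrix.of fun i _ => (Pi.single a (1 : ℝ) : ι → ℝ) i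
  let V : Matrix (Fin 1) ι ℝ := Matrix.of ![f - Pi.single a 1]
  have : (Matrix.of fun i => if i = a then f else Pi.single i 1) = 1 + U * V := by
    ext i j
    simp only [Matrix.of_apply, Matrix.add_apply, Matrix.mul_apply, Fin.sum_univ_one, U, V,
      Matrix.one_apply, Pi.single_apply]
    rcases eq_or_ne i a with rfl | hia
    · simp [Pi.single_apply, eq_comm]
    · simp [hia, Pi.single_apply, eq_comm]
  rw [this, Matrix.det_one_add_mul_comm, Matrix.det_fin_one]
  simp [U, V, Matrix.vecMul, dotProduct, Pi.single_apply]

theorem eq_zero_of_int_of_abs_lt_one {x : ℝ} (h : ∃ n : ℤ, x = n) (hx : |x| < 1) : x = 0 := by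
  obtain ⟨n, rfl⟩ := h
  have : |n| < 1 := by exact_mod_cast hx
  simpa using Int.abs_lt_one_iff.1 this

/-- An integer vector orthogonal to one vector `f`, inside a box of size comparable to `B`. -/
theorem exists_int_in_box_of_form {ι : Type*} [Fintype ι] [DecidableEq ι] (G : Matrix ι ι ℝ)
    (hG : G.det = 1) (f B : ι → ℝ) (hB : ∀ i, 0 < B i)
    (hf : ∀ w : ι → ℤ, ∃ n : ℤ, f ⬝ᵥ (G *ᵥ fun j => (w j : ℝ)) = n)
    (hlt : ∀ a, |f a| * B a < ∏ i, B i) (hne : f ≠ 0) :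
    ∃ w : ι → ℤ, w ≠ 0 ∧ ∀ i, |(G *ᵥ fun j => (w j : ℝ)) i| ≤ Fintype.card ι * B i := by
  obtain ⟨a₀, ha₀⟩ := Function.ne_iff.1 hne
  -- The coordinate to discard is the one where `|f a| * B a` is largest: solving `f ⬝ᵥ g = 0` for
  -- it then costs at most a factor `card ι`.
  obtain ⟨a, -, hmax⟩ := Finset.exists_max_image Finset.univ (fun a => |f a| * B a) ⟨a₀, by simp⟩
  have hfa : 0 < |f a| := by
    have h1 : 0 < |f a₀| * B a₀ := mul_pos (abs_pos.2 ha₀) (hB _)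
    exact pos_of_mul_pos_left (h1.trans_le (hmax a₀ (by simp))) (hB a).le
  let N : Matrix ι ι ℝ := Matrix.of fun i => if i = a then f else Pi.single i 1
  have hdet : (N * G).det = f a := by
    rw [Matrix.det_mul, hG, mul_one, det_one_updateRow_single]
  have hN : ∀ v i, (N *ᵥ v) i = if i = a then f ⬝ᵥ v else v i := by
    intro v i
    simp only [N, Matrix.mulVec, Matrix.of_apply]
    split_ifs <;> simp
  -- Form `a` is replaced by `f` with bound 1, which forces the integer `f ⬝ᵥ g` to vanish.
  obtain ⟨w, hw0, hw⟩ := exists_int_forms_lt (N * G) (by rw [hdet]; exact abs_pos.1 hfa)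
    (fun i => if i = a then 1 else B i) (fun i => by split_ifs <;> simp [hB])
    (by
      rw [hdet]
      have : ∏ i, B i = (∏ i, if i = a then 1 else B i) * B a := by
        rw [← Finset.prod_erase_mul _ _ (Finset.mem_univ a),
          ← Finset.prod_erase_mul _ (fun i => if i = a then 1 else B i) (Finset.mem_univ a)]
        simp only [if_true, mul_one]
        congr 1
        exact Finset.prod_congr rfl fun i hi => by simp [Finset.ne_of_mem_erase hi]
      have h := hlt a
      rw [this] at h
      exact lt_of_mul_lt_mul_right h (hB a).le)
  refine ⟨w, hw0, ?_⟩
  set g := G *ᵥ fun j => (w j : ℝ) with hg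
  simp only [← Matrix.mulVec_mulVec, ← hg, hN] at hw
  have hfg : f ⬝ᵥ g = 0 := eq_zero_of_int_of_abs_lt_one (hf w) (by simpa using hw a)
  have hcard : (1 : ℝ) ≤ Fintype.card ι := by
    exact_mod_cast Fintype.card_pos_iff.2 ⟨a⟩
  have hother : ∀ i, i ≠ a → |g i| ≤ B i := fun i hi => by simpa [hi] using (hw i).le
  intro i
  by_cases hi : i = a
  · subst hi
    have h1 : f i * g i = -∑ j ∈ Finset.univ.erase i, f j * g j := by
      have := Finset.add_sum_erase Finset.univ (fun j => f j * g j) (Finset.mem_univ i)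
      simp only [dotProduct] at hfg
      linarith
    have h2 : |f i| * |g i| ≤ ∑ j ∈ Finset.univ.erase i, |f i| * B i := by
      rw [← abs_mul, h1, abs_neg]
      refine (Finset.abs_sum_le_sum_abs _ _).trans (Finset.sum_le_sum fun j hj => ?_)
      rw [abs_mul]
      exact (mul_le_mul_of_nonneg_left (hother j (Finset.ne_of_mem_erase hj))
        (abs_nonneg _)).trans (hmax j (by simp))
    have h3 : ∑ j ∈ Finset.univ.erase i, |f i| * B i ≤ ∑ j : ι, |f i| * B i :=
      Finset.sum_le_sum_of_subset_of_nonneg (Finset.erase_subset _ _)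
        fun _ _ _ => mul_nonneg hfa.le (hB i).le
    rw [Finset.sum_const (s := Finset.univ), nsmul_eq_mul, Finset.card_univ] at h3
    refine le_of_mul_le_mul_left ?_ hfa
    linarith
  · exact (hother i hi).trans (le_mul_of_one_le_left (hB i).le hcard)

/-- An integer vector orthogonal to two independent vectors `f`, `g`, inside a box of size
comparable to `B`. -/
theorem exists_int_in_box_of_pair {ι : Type*} [Fintype ι] [DecidableEq ι] (G : Matrix ι ι ℝ)
    (hG : G.det = 1) (f g B : ι → ℝ) (hB : ∀ i, 0 < B i)
    (hf : ∀ w : ι → ℤ, ∃ n : ℤ, f ⬝ᵥ (G *ᵥ fun j => (w j : ℝ)) = n)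
    (hg : ∀ w : ι → ℤ, ∃ n : ℤ, g ⬝ᵥ (G *ᵥ fun j => (w j : ℝ)) = n)
    (hlt : ∀ a b, a ≠ b → |f a * g b - f b * g a| * (B a * B b) < ∏ i, B i)
    (hne : ∃ a b, f a * g b - f b * g a ≠ 0) :
    ∃ w : ι → ℤ, w ≠ 0 ∧ ∀ i, |(G *ᵥ fun j => (w j : ℝ)) i| ≤ Fintype.card ι * B i := by
  obtain ⟨a₀, b₀, hab₀⟩ := hne
  set M : ι → ι → ℝ := fun a b => f a * g b - f b * g a with hM
  -- As with one form, the discarded pair maximizes the minor weighted by the box.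
  obtain ⟨⟨a, b⟩, -, hmax'⟩ := Finset.exists_max_image Finset.univ
    (fun p : ι × ι => |M p.1 p.2| * (B p.1 * B p.2)) ⟨(a₀, b₀), by simp⟩
  have hmax : ∀ c d, |M c d| * (B c * B d) ≤ |M a b| * (B a * B b) :=
    fun c d => hmax' (c, d) (by simp)
  have hMab : 0 < |M a b| := by
    have h1 : 0 < |M a₀ b₀| * (B a₀ * B b₀) := mul_pos (abs_pos.2 hab₀) (mul_pos (hB _) (hB _))
    exact pos_of_mul_pos_left (h1.trans_le (hmax a₀ b₀)) (mul_pos (hB a) (hB b)).le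
  have hab : a ≠ b := by
    rintro rfl
    simp [hM] at hMab
  let N : Matrix ι ι ℝ :=
    Matrix.of fun i => if i = a then f else if i = b then g else Pi.single i 1
  have hdet : (N * G).det = M a b := by
    rw [Matrix.det_mul, hG, mul_one, det_one_updateRow_pair hab]
  have hN : ∀ v i, (N *ᵥ v) i = if i = a then f ⬝ᵥ v else if i = b then g ⬝ᵥ v else v i := by
    intro v i
    simp only [N, Matrix.mulVec, Matrix.of_apply]
    split_ifs <;> simp
  obtain ⟨w, hw0, hw⟩ := exists_int_forms_lt (N * G) (by rw [hdet]; exact abs_pos.1 hMab)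
    (fun i => if i = a then 1 else if i = b then 1 else B i)
    (fun i => by split_ifs <;> simp [hB])
    (by
      rw [hdet]
      have : ∏ i, B i = (∏ i, if i = a then 1 else if i = b then 1 else B i) * (B a * B b) := by
        have hb : b ∈ Finset.univ.erase a := by simp [hab.symm]
        rw [← Finset.prod_erase_mul _ _ (Finset.mem_univ a), ← Finset.prod_erase_mul _ _ hb,
          ← Finset.prod_erase_mul _ (fun i => if i = a then 1 else if i = b then 1 else B i)
            (Finset.mem_univ a), ← Finset.prod_erase_mul _ _ hb]
        simp only [if_true, mul_one, hab.symm, if_false]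
        rw [mul_assoc, mul_comm (B b)]
        congr 1
        exact Finset.prod_congr rfl fun i hi => by
          simp only [Finset.mem_erase] at hi
          simp [hi.1, hi.2.1]
      have h := hlt a b hab
      rw [this] at h
      exact lt_of_mul_lt_mul_right h (mul_pos (hB a) (hB b)).le)
  refine ⟨w, hw0, ?_⟩
  set u := G *ᵥ fun j => (w j : ℝ) with hu
  simp only [← Matrix.mulVec_mulVec, ← hu, hN] at hw
  have hfu : f ⬝ᵥ u = 0 := eq_zero_of_int_of_abs_lt_one (hf w) (by simpa using hw a)
  have hgu : g ⬝ᵥ u = 0 :=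
    eq_zero_of_int_of_abs_lt_one (hg w) (by simpa [hab.symm] using hw b)
  have hcard : (1 : ℝ) ≤ Fintype.card ι := by
    exact_mod_cast Fintype.card_pos_iff.2 ⟨a⟩
  have hother : ∀ i, i ≠ a → i ≠ b → |u i| ≤ B i :=
    fun i hi hi' => by simpa [hi, hi'] using (hw i).le
  -- The combination `g k • f - f k • g` has coefficients `M j k`, hence does not involve coordinate
  -- `k`. With `{i, k} = {a, b}` it expresses `u i` through coordinates already bounded.
  have key : ∀ i k, (∀ j, j ≠ i → M j k ≠ 0 → |u j| ≤ B j) →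
      (∀ j, |M j k| * (B j * B k) ≤ |M i k| * (B i * B k)) → 0 < |M i k| →
      |u i| ≤ Fintype.card ι * B i := by
    intro i k hoth hmx hpos
    have h0 : ∑ j, M j k * u j = 0 := by
      have : ∑ j, M j k * u j = g k * (f ⬝ᵥ u) - f k * (g ⬝ᵥ u) := by
        simp only [dotProduct, Finset.mul_sum, ← Finset.sum_sub_distrib, hM]
        exact Finset.sum_congr rfl fun j _ => by ring
      rw [this, hfu, hgu]; ring
    have h1 : M i k * u i = -∑ j ∈ Finset.univ.erase i, M j k * u j := by
      have := Finset.add_sum_erase Finset.univ (fun j => M j k * u j) (Finset.mem_univ i)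
      linarith
    have h2 : |M i k| * |u i| ≤ ∑ j ∈ Finset.univ.erase i, |M i k| * B i := by
      rw [← abs_mul, h1, abs_neg]
      refine (Finset.abs_sum_le_sum_abs _ _).trans (Finset.sum_le_sum fun j hj => ?_)
      rw [abs_mul]
      by_cases hz : M j k = 0
      · rw [hz, abs_zero, zero_mul]
        exact mul_nonneg hpos.le (hB i).le
      · refine (mul_le_mul_of_nonneg_left (hoth j (Finset.ne_of_mem_erase hj) hz)
          (abs_nonneg _)).trans ?_
        have := hmx j
        rw [← mul_assoc, ← mul_assoc] at this
        exact le_of_mul_le_mul_right this (hB k)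
    have h3 : ∑ j ∈ Finset.univ.erase i, |M i k| * B i ≤ ∑ j : ι, |M i k| * B i :=
      Finset.sum_le_sum_of_subset_of_nonneg (Finset.erase_subset _ _)
        fun _ _ _ => mul_nonneg hpos.le (hB i).le
    rw [Finset.sum_const (s := Finset.univ), nsmul_eq_mul, Finset.card_univ] at h3
    refine le_of_mul_le_mul_left ?_ hpos
    linarith
  have hMdiag : ∀ i, M i i = 0 := fun i => by simp [hM]
  have hMswap : ∀ i j, |M i j| = |M j i| := fun i j => by
    rw [← abs_neg]; congr 1; simp only [hM]; ring
  intro i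
  by_cases hi : i = a
  · subst hi
    exact key i b (fun j hj hz => hother j hj fun h => hz (by rw [h, hMdiag]))
      (fun j => hmax j b) hMab
  · by_cases hi' : i = b
    · subst hi'
      refine key i a (fun j hj hz => hother j (fun h => hz (by rw [h, hMdiag])) hj)
        (fun j => ?_) (by rwa [hMswap])
      have := hmax j a
      rwa [hMswap i a, mul_comm (B i)]
    · exact (hother i hi hi').trans (le_mul_of_one_le_left (hB i).le hcard)

/-! ### The pair of dual lattices. -/

/-- The matrix of `z ↦ (z₀ + ∑ θ_j z_j, z_1, …, z_m)`. -/
def primalMatrix {m : ℕ} (θ : Fin m → ℝ) : Matrix (Option (Fin m)) (Option (Fin m)) ℝ :=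
  Matrix.of fun i => if i = none then fun o => o.elim 1 θ else Pi.single i 1

/-- The matrix of `w ↦ (w₀, w_1 - θ_1 w₀, …, w_m - θ_m w₀)`. -/
def dualMatrix {m : ℕ} (θ : Fin m → ℝ) : Matrix (Option (Fin m)) (Option (Fin m)) ℝ :=
  (Matrix.of fun i => if i = none then fun o => o.elim 1 (fun j => -θ j) else Pi.single i 1)ᵀ

theorem det_primalMatrix {m : ℕ} (θ : Fin m → ℝ) : (primalMatrix θ).det = 1 := by
  rw [primalMatrix, det_one_updateRow_single]; rfl

theorem det_dualMatrix {m : ℕ} (θ : Fin m → ℝ) : (dualMatrix θ).det = 1 := by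
  rw [dualMatrix, Matrix.det_transpose, det_one_updateRow_single]; rfl

/-- The point of the primal lattice with integer coordinates `z`. -/
def primalPt {m : ℕ} (θ : Fin m → ℝ) (z : Option (Fin m) → ℤ) : Option (Fin m) → ℝ :=
  primalMatrix θ *ᵥ fun o => (z o : ℝ)

/-- The point of the dual lattice with integer coordinates `w`. -/
def dualPt {m : ℕ} (θ : Fin m → ℝ) (w : Option (Fin m) → ℤ) : Option (Fin m) → ℝ :=
  dualMatrix θ *ᵥ fun o => (w o : ℝ)

section

variable {m : ℕ} (θ : Fin m → ℝ)

@[simp] theorem primalPt_none (z : Option (Fin m) → ℤ) :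
    primalPt θ z none = z none + ∑ j, θ j * z (some j) := by
  simp [primalPt, primalMatrix, Matrix.mulVec, dotProduct, Fintype.sum_option]

@[simp] theorem primalPt_some (z : Option (Fin m) → ℤ) (j : Fin m) :
    primalPt θ z (some j) = z (some j) := by
  simp [primalPt, primalMatrix, Matrix.mulVec, dotProduct, Pi.single_apply]

@[simp] theorem dualPt_none (w : Option (Fin m) → ℤ) : dualPt θ w none = w none := by
  simp [dualPt, dualMatrix, Matrix.mulVec, dotProduct, Fintype.sum_option]

@[simp] theorem dualPt_some (w : Option (Fin m) → ℤ) (j : Fin m) :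
    dualPt θ w (some j) = w (some j) - θ j * w none := by
  simp [dualPt, dualMatrix, Matrix.mulVec, dotProduct, Fintype.sum_option, Pi.single_apply]
  ring

/-- The terms containing `θ` cancel. This integrality is what lets points of one lattice serve as
forms on the other. -/
theorem primalPt_dotProduct_dualPt (z w : Option (Fin m) → ℤ) :
    primalPt θ z ⬝ᵥ dualPt θ w = ((∑ o, z o * w o : ℤ) : ℝ) := by
  simp only [dotProduct, Fintype.sum_option, primalPt_none, primalPt_some, dualPt_none,
    dualPt_some, Int.cast_add, Int.cast_sum, Int.cast_mul, mul_sub, Finset.sum_sub_distrib,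
    add_mul, Finset.sum_mul]
  have : ∑ j, (z (some j) : ℝ) * (θ j * w none) = ∑ j, θ j * z (some j) * w none :=
    Finset.sum_congr rfl fun j _ => by ring
  rw [this]; ring

theorem primalPt_ne_zero {z : Option (Fin m) → ℤ} (hz : z ≠ 0) : primalPt θ z ≠ 0 := by
  intro h
  have h1 : ∀ j, z (some j) = 0 := fun j => by
    have := congrFun h (some j)
    simpa using this
  refine hz (funext fun o => ?_)
  cases o with
  | none => simpa [h1] using congrFun h none
  | some j => exact h1 j

theorem dualPt_ne_zero {w : Option (Fin m) → ℤ} (hw : w ≠ 0) : dualPt θ w ≠ 0 := by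
  intro h
  have h0 : w none = 0 := by simpa using congrFun h none
  refine hw (funext fun o => ?_)
  cases o with
  | none => exact h0
  | some j => simpa [h0] using congrFun h (some j)

end

/-! ### The Diophantine systems as lattice points in boxes. -/

/-- A nonzero primal lattice point in the box of the system with exponent `γ` at scale `t`. -/
def PrimalSol {m : ℕ} (σ θ : Fin m → ℝ) (γ t : ℝ) : Prop :=
  ∃ z : Option (Fin m) → ℤ, z ≠ 0 ∧ (∀ j, |primalPt θ z (some j)| ≤ t ^ σ j) ∧
    |primalPt θ z none| ≤ t ^ (-γ)

/-- A nonzero dual lattice point in the box of the system with exponent `δ` at scale `t`. -/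
def DualSol {m : ℕ} (σ θ : Fin m → ℝ) (δ t : ℝ) : Prop :=
  ∃ w : Option (Fin m) → ℤ, w ≠ 0 ∧ |dualPt θ w none| ≤ t ∧
    ∀ j, |dualPt θ w (some j)| ≤ t ^ (-(δ * σ j))

theorem weightedNorm_le_iff {k : ℕ} [Nonempty (Fin k)] {w : Fin k → ℝ} (hw : ∀ j, 0 < w j)
    (x : Fin k → ℝ) {t : ℝ} (ht : 0 < t) :
    weightedNorm w x ≤ t ↔ ∀ j, |x j| ≤ t ^ w j := by
  rw [weightedNorm, ciSup_le_iff (Set.finite_range _).bddAbove]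
  refine forall_congr' fun j => ?_
  rw [one_div, Real.rpow_inv_le_iff_of_pos (abs_nonneg _) ht.le (hw j)]

theorem hasNonzeroSolution_iff_primalSol {m : ℕ} (hm : 0 < m) {σ : Fin m → ℝ}
    (hσ : ∀ j, 0 < σ j) {ρ : Fin 1 → ℝ} (hρ : ρ 0 = 1) (Θ : Matrix (Fin 1) (Fin m) ℝ) (γ : ℝ)
    {t : ℝ} (ht : 0 < t) : HasNonzeroSolution σ ρ Θ γ t ↔ PrimalSol σ (Θ 0) γ t := by
  have : Nonempty (Fin m) := ⟨⟨0, hm⟩⟩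
  have hρ' : ∀ i, 0 < ρ i := fun i => by rw [Subsingleton.elim i 0, hρ]; norm_num
  simp only [HasNonzeroSolution, PrimalSol, weightedNorm_le_iff hσ _ ht,
    weightedNorm_le_iff hρ' _ (Real.rpow_pos_of_pos ht _), Fin.forall_fin_one, hρ, Real.rpow_one,
    primalPt_none, primalPt_some, Pi.sub_apply, Matrix.mulVec, dotProduct]
  constructor
  · rintro ⟨x, y, hne, h1, h2⟩
    refine ⟨fun o => o.elim (-y 0) x, fun h => hne ?_, h1, ?_⟩
    · ext i
      · exact congrFun h (some i)
      · rw [Subsingleton.elim i 0]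
        simpa using congrFun h none
    · convert h2 using 2
      simp only [Option.elim, Int.cast_neg]
      ring
  · rintro ⟨z, hne, h1, h2⟩
    refine ⟨fun j => z (some j), fun _ => -z none, fun h => hne ?_, h1, ?_⟩
    · rw [Prod.mk_eq_zero] at h
      ext o
      cases o with
      | none => simpa using congrFun h.2 0
      | some j => exact congrFun h.1 j
    · convert h2 using 2
      push_cast
      ring

theorem hasNonzeroSolution_iff_dualSol {m : ℕ} (hm : 0 < m) {σ : Fin m → ℝ}
    (hσ : ∀ j, 0 < σ j) {ρ : Fin 1 → ℝ} (hρ : ρ 0 = 1) (Θ : Matrix (Fin 1) (Fin m) ℝ) (δ : ℝ)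
    {t : ℝ} (ht : 0 < t) : HasNonzeroSolution ρ σ Θᵀ δ t ↔ DualSol σ (Θ 0) δ t := by
  have : Nonempty (Fin m) := ⟨⟨0, hm⟩⟩
  have hρ' : ∀ i, 0 < ρ i := fun i => by rw [Subsingleton.elim i 0, hρ]; norm_num
  simp only [HasNonzeroSolution, DualSol, weightedNorm_le_iff hρ' _ ht,
    weightedNorm_le_iff hσ _ (Real.rpow_pos_of_pos ht _), Fin.forall_fin_one, hρ, Real.rpow_one,
    dualPt_none, dualPt_some, Pi.sub_apply, Matrix.mulVec, dotProduct, Fin.sum_univ_one,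
    Matrix.transpose_apply, ← Real.rpow_mul ht.le, neg_mul]
  constructor
  · rintro ⟨x, y, hne, h1, h2⟩
    refine ⟨fun o => o.elim (x 0) y, fun h => hne ?_, h1, fun j => ?_⟩
    · ext i
      · rw [Subsingleton.elim i 0]
        exact congrFun h none
      · exact congrFun h (some i)
    · rw [abs_sub_comm]
      exact h2 j
  · rintro ⟨w, hne, h1, h2⟩
    refine ⟨fun _ => w none, fun j => w (some j), fun h => hne ?_, h1, fun j => ?_⟩
    · rw [Prod.mk_eq_zero] at h
      ext o
      cases o with
      | none => exact congrFun h.1 0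
      | some j => exact congrFun h.2 j
    · rw [abs_sub_comm]
      exact h2 j

/-! ### Absorbing multiplicative constants into the exponent. -/

theorem eventually_const_mul_rpow_le (C : ℝ) {a b : ℝ} (hab : a < b) :
    ∀ᶠ t : ℝ in Filter.atTop, C * t ^ a ≤ t ^ b := by
  filter_upwards [(tendsto_rpow_atTop (sub_pos.2 hab)).eventually_ge_atTop C,
    Filter.eventually_gt_atTop 0] with t h ht
  calc C * t ^ a ≤ t ^ (b - a) * t ^ a := by gcongr
    _ = t ^ b := by rw [← Real.rpow_add ht, sub_add_cancel]

theorem exists_scale {γ γ' : ℝ} (hγ : 0 < γ) (h : γ' < γ) : ∃ r, 0 < r ∧ r < 1 ∧ γ' < r * γ := by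
  obtain ⟨r, h1, h2⟩ := exists_between (max_lt ((div_lt_one hγ).2 h) zero_lt_one)
  rw [max_lt_iff] at h1
  exact ⟨r, h1.2, h2, (div_lt_iff₀ hγ).1 h1.1⟩

/-- A constant `C` is harmless after a strict loss in the exponent: apply the hypothesis at scale `s
= t ^ r` with `r < 1` and `γ' < r * γ`, so every bound gains a positive power of `t`. -/
theorem eventually_primalSol_of_const {m : ℕ} {σ : Fin m → ℝ} (hσ : ∀ j, 0 < σ j)
    (θ : Fin m → ℝ) {γ γ' : ℝ} (hγ : 0 < γ) (hlt : γ' < γ) (C : ℝ)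
    (h : ∀ᶠ s : ℝ in Filter.atTop, ∃ z : Option (Fin m) → ℤ, z ≠ 0 ∧
      (∀ j, |primalPt θ z (some j)| ≤ C * s ^ σ j) ∧ |primalPt θ z none| ≤ C * s ^ (-γ)) :
    ∀ᶠ t : ℝ in Filter.atTop, PrimalSol σ θ γ' t := by
  obtain ⟨r, hr0, hr1, hr⟩ := exists_scale hγ hlt
  filter_upwards [(tendsto_rpow_atTop hr0).eventually h, Filter.eventually_gt_atTop 0,
    eventually_const_mul_rpow_le C (show r * -γ < -γ' by linarith),
    Filter.eventually_all.2 fun j => eventually_const_mul_rpow_le C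
      (show r * σ j < σ j by nlinarith [hσ j])] with t ⟨z, hz, h1, h2⟩ ht h3 h4
  rw [Real.rpow_mul ht.le] at h3
  refine ⟨z, hz, fun j => (h1 j).trans ?_, h2.trans h3⟩
  rw [← Real.rpow_mul ht.le]
  exact h4 j

theorem eventually_dualSol_of_const {m : ℕ} {σ : Fin m → ℝ} (hσ : ∀ j, 0 < σ j)
    (θ : Fin m → ℝ) {δ δ' : ℝ} (hδ : 0 < δ) (hlt : δ' < δ) (C : ℝ)
    (h : ∀ᶠ s : ℝ in Filter.atTop, ∃ w : Option (Fin m) → ℤ, w ≠ 0 ∧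
      |dualPt θ w none| ≤ C * s ∧ ∀ j, |dualPt θ w (some j)| ≤ C * s ^ (-(δ * σ j))) :
    ∀ᶠ t : ℝ in Filter.atTop, DualSol σ θ δ' t := by
  obtain ⟨r, hr0, hr1, hr⟩ := exists_scale hδ hlt
  filter_upwards [(tendsto_rpow_atTop hr0).eventually h, Filter.eventually_gt_atTop 0,
    eventually_const_mul_rpow_le C hr1,
    Filter.eventually_all.2 fun j => eventually_const_mul_rpow_le C
      (show r * -(δ * σ j) < -(δ' * σ j) by nlinarith [hσ j])] with t ⟨z, hz, h1, h2⟩ ht h3 h4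
  rw [Real.rpow_one] at h3
  refine ⟨z, hz, h1.trans h3, fun j => (h2 j).trans ?_⟩
  rw [← Real.rpow_mul ht.le]
  exact h4 j

/-! ### Boxes whose sides are powers of the scale. -/

/-- The exponents `1`, `-δ σ_j` of the dual box. -/
def dualExp {m : ℕ} (σ : Fin m → ℝ) (δ : ℝ) (o : Option (Fin m)) : ℝ :=
  o.elim 1 fun j => -(δ * σ j)

/-- The exponents `-γ`, `σ_j` of the primal box. -/
def primalExp {m : ℕ} (σ : Fin m → ℝ) (γ : ℝ) (o : Option (Fin m)) : ℝ :=
  o.elim (-γ) σ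

theorem sum_dualExp {m : ℕ} {σ : Fin m → ℝ} (hσ : ∑ j, σ j = 1) (δ : ℝ) :
    ∑ o, dualExp σ δ o = 1 - δ := by
  simp only [dualExp, Fintype.sum_option, Option.elim, Finset.sum_neg_distrib, ← Finset.mul_sum, hσ]
  ring

theorem sum_primalExp {m : ℕ} {σ : Fin m → ℝ} (hσ : ∑ j, σ j = 1) (γ : ℝ) :
    ∑ o, primalExp σ γ o = 1 - γ := by
  simp only [primalExp, Fintype.sum_option, Option.elim, hσ]
  ring

theorem prod_const_mul_rpow {ι : Type*} [Fintype ι] (e : ι → ℝ) (C : ℝ) {s : ℝ} (hs : 0 < s) :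
    ∏ i, C * s ^ e i = C ^ Fintype.card ι * s ^ ∑ i, e i := by
  simp only [Finset.prod_mul_distrib, Finset.prod_const, Finset.card_univ,
    ← Real.rpow_sum_of_pos hs]

theorem exists_int_in_rpow_box {ι : Type*} [Fintype ι] [DecidableEq ι] [Nonempty ι]
    {G : Matrix ι ι ℝ} (hG : G.det = 1) (e : ι → ℝ) (he : ∑ i, e i = 0) {s : ℝ} (hs : 0 < s) :
    ∃ w : ι → ℤ, w ≠ 0 ∧ ∀ i, |(G *ᵥ fun j => (w j : ℝ)) i| ≤ 2 * s ^ e i := by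
  obtain ⟨w, hw, h⟩ := exists_int_forms_lt G (by simp [hG]) (fun i => 2 * s ^ e i)
    (fun i => by positivity) (by
      rw [prod_const_mul_rpow _ _ hs, hG, he]
      simpa using one_lt_pow₀ (one_lt_two (α := ℝ)) Fintype.card_ne_zero)
  exact ⟨w, hw, fun i => (h i).le⟩

theorem exists_int_in_rpow_box_of_form {ι : Type*} [Fintype ι] [DecidableEq ι]
    (hι : 3 ≤ Fintype.card ι) {G : Matrix ι ι ℝ} (hG : G.det = 1) (e : ι → ℝ) {E : ℝ}
    (he : ∑ i, e i = E) {s : ℝ} (hs : 0 < s) {K : ℝ} (hK : 0 ≤ K) {f : ι → ℝ}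
    (hf : ∀ w : ι → ℤ, ∃ n : ℤ, f ⬝ᵥ (G *ᵥ fun j => (w j : ℝ)) = n) (hne : f ≠ 0)
    (hle : ∀ a, |f a| ≤ K * s ^ (E - e a)) :
    ∃ w : ι → ℤ, w ≠ 0 ∧ ∀ i, |(G *ᵥ fun j => (w j : ℝ)) i|
      ≤ Fintype.card ι * (K + 1) * s ^ e i := by
  simp only [mul_assoc]
  refine exists_int_in_box_of_form G hG f (fun i => (K + 1) * s ^ e i) (fun i => by positivity)
    hf (fun a => ?_) hne
  rw [prod_const_mul_rpow _ _ hs, he]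
  calc |f a| * ((K + 1) * s ^ e a) ≤ K * s ^ (E - e a) * ((K + 1) * s ^ e a) :=
        mul_le_mul_of_nonneg_right (hle a) (by positivity)
    _ = K * (K + 1) * s ^ E := by
        rw [show s ^ E = s ^ (E - e a) * s ^ e a by rw [← Real.rpow_add hs, sub_add_cancel]]
        ring
    _ < (K + 1) ^ Fintype.card ι * s ^ E := by
        refine mul_lt_mul_of_pos_right ?_ (by positivity)
        -- Enlarging the sides by `K + 1` gives the strict inequality needed for Minkowski.
        calc K * (K + 1) < (K + 1) ^ 2 := by nlinarith
          _ ≤ _ := pow_le_pow_right₀ (by linarith) (by omega)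

theorem exists_int_in_rpow_box_of_pair {ι : Type*} [Fintype ι] [DecidableEq ι]
    (hι : 3 ≤ Fintype.card ι) {G : Matrix ι ι ℝ} (hG : G.det = 1) (e : ι → ℝ) {E : ℝ}
    (he : ∑ i, e i = E) {s : ℝ} (hs : 0 < s) {K : ℝ} (hK : 0 ≤ K) {f g : ι → ℝ}
    (hf : ∀ w : ι → ℤ, ∃ n : ℤ, f ⬝ᵥ (G *ᵥ fun j => (w j : ℝ)) = n)
    (hg : ∀ w : ι → ℤ, ∃ n : ℤ, g ⬝ᵥ (G *ᵥ fun j => (w j : ℝ)) = n)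
    (hne : ∃ a b, f a * g b - f b * g a ≠ 0)
    (hle : ∀ a b, a ≠ b → |f a * g b - f b * g a| ≤ K * s ^ (E - e a - e b)) :
    ∃ w : ι → ℤ, w ≠ 0 ∧ ∀ i, |(G *ᵥ fun j => (w j : ℝ)) i|
      ≤ Fintype.card ι * (K + 1) * s ^ e i := by
  simp only [mul_assoc]
  refine exists_int_in_box_of_pair G hG f g (fun i => (K + 1) * s ^ e i)
    (fun i => by positivity) hf hg (fun a b hab => ?_) hne
  rw [prod_const_mul_rpow _ _ hs, he]
  calc |f a * g b - f b * g a| * ((K + 1) * s ^ e a * ((K + 1) * s ^ e b))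
      ≤ K * s ^ (E - e a - e b) * ((K + 1) * s ^ e a * ((K + 1) * s ^ e b)) :=
        mul_le_mul_of_nonneg_right (hle a b hab) (by positivity)
    _ = K * (K + 1) ^ 2 * s ^ E := by
        rw [show s ^ E = s ^ (E - e a - e b) * s ^ e a * s ^ e b by
          rw [← Real.rpow_add hs, ← Real.rpow_add hs]; congr 1; ring]
        ring
    _ < (K + 1) ^ Fintype.card ι * s ^ E := by
        refine mul_lt_mul_of_pos_right ?_ (by positivity)
        -- Two sides are used up by the minor, so a third one is needed for strictness: this is
        -- where dimension at least 3, i.e. `m ≥ 2`, enters.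
        calc K * (K + 1) ^ 2 < (K + 1) ^ 3 := by nlinarith [sq_nonneg (K + 1)]
          _ ≤ _ := pow_le_pow_right₀ (by linarith) hι

theorem forall_option_pair {α : Type*} {p : Option α → Option α → Prop}
    (hsymm : ∀ a b, p a b → p b a) (h₀ : ∀ j, p none (some j))
    (h : ∀ i j, i ≠ j → p (some i) (some j)) : ∀ a b, a ≠ b → p a b
  | none, none, hab => absurd rfl hab
  | none, some j, _ => h₀ j
  | some i, none, _ => hsymm _ _ (h₀ i)
  | some i, some j, hab => h i j fun hij => hab (by rw [hij])

theorem minor_bound_symm {ι : Type*} {f g e : ι → ℝ} {K s E : ℝ} (a b : ι)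
    (h : |f a * g b - f b * g a| ≤ K * s ^ (E - e a - e b)) :
    |f b * g a - f a * g b| ≤ K * s ^ (E - e b - e a) := by
  rwa [abs_sub_comm, sub_right_comm]

/-! ### Dirichlet's theorem: every exponent below 1 is admissible. -/

theorem eventually_primalSol_of_lt_one {m : ℕ} {σ : Fin m → ℝ} (hσ : ∀ j, 0 < σ j)
    (hsum : ∑ j, σ j = 1) (θ : Fin m → ℝ) {γ : ℝ} (hγ : γ < 1) :
    ∀ᶠ t : ℝ in Filter.atTop, PrimalSol σ θ γ t := by
  refine eventually_primalSol_of_const hσ θ one_pos hγ 2 ?_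
  filter_upwards [Filter.eventually_gt_atTop 0] with s hs
  obtain ⟨z, hz, h⟩ := exists_int_in_rpow_box (det_primalMatrix θ) (primalExp σ 1)
    (by rw [sum_primalExp hsum, sub_self]) hs
  exact ⟨z, hz, fun j => h (some j), h none⟩

theorem eventually_dualSol_of_lt_one {m : ℕ} {σ : Fin m → ℝ} (hσ : ∀ j, 0 < σ j)
    (hsum : ∑ j, σ j = 1) (θ : Fin m → ℝ) {δ : ℝ} (hδ : δ < 1) :
    ∀ᶠ t : ℝ in Filter.atTop, DualSol σ θ δ t := by
  refine eventually_dualSol_of_const hσ θ one_pos hδ 2 ?_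
  filter_upwards [Filter.eventually_gt_atTop 0] with s hs
  obtain ⟨z, hz, h⟩ := exists_int_in_rpow_box (det_dualMatrix θ) (dualExp σ 1)
    (by rw [sum_dualExp hsum, sub_self]) hs
  refine ⟨z, hz, ?_, fun j => h (some j)⟩
  simpa [dualExp, dualPt] using h none

theorem abs_minor_le {a b c d A B C D : ℝ} (ha : |a| ≤ A) (hb : |b| ≤ B) (hc : |c| ≤ C)
    (hd : |d| ≤ D) : |a * d - b * c| ≤ A * D + B * C := by
  refine (abs_sub _ _).trans ?_
  rw [abs_mul, abs_mul]
  have := abs_nonneg a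
  have := abs_nonneg b
  have := abs_nonneg c
  have := abs_nonneg d
  gcongr <;> linarith

theorem minor_ne_zero_of_abs_lt {a b c d : ℝ} (h₁ : |c| ≤ |a|) (h₂ : |b| < |d|) (ha : a ≠ 0) :
    a * d - b * c ≠ 0 := by
  intro h
  have h1 : |a| * |d| = |b| * |c| := by rw [← abs_mul, ← abs_mul, sub_eq_zero.1 h]
  have := abs_pos.2 ha
  nlinarith [abs_nonneg b]

/-! ### Transference between the two systems. -/

theorem eventually_dualSol_of_primalSol {m : ℕ} (hm : 2 ≤ m) {σ : Fin m → ℝ}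
    (hσ : ∀ j, 0 < σ j) (hsum : ∑ j, σ j = 1) {σm : ℝ} (hσm : ∀ j, σm ≤ σ j) (hσm1 : σm < 1)
    (θ : Fin m → ℝ) {γ δ δ' : ℝ} (hγ : 1 ≤ γ) (hδ : δ * (1 - σm) = 1 - σm * γ⁻¹)
    (hδ' : δ' < δ) (hσm0 : 0 < σm) (h : ∀ᶠ t : ℝ in Filter.atTop, PrimalSol σ θ γ t) :
    ∀ᶠ t : ℝ in Filter.atTop, DualSol σ θ δ' t := by
  have hγ0 : 0 < γ := by linarith
  set η := γ⁻¹ with hη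
  have hη0 : 0 < η := inv_pos.2 hγ0
  have hη1 : η ≤ 1 := inv_le_one_of_one_le₀ hγ
  have hγη : γ * η = 1 := mul_inv_cancel₀ hγ0.ne'
  have hδ1 : 1 ≤ δ := by nlinarith
  -- Equivalent to `δ - 1 ≤ σ j * (δ - η)`; since `η ≤ δ`, the least weight is the worst case, and
  -- there `hδ` gives equality.
  have key : ∀ j, σ j * η ≤ 1 - δ + δ * σ j := fun j => by nlinarith [hσm j]
  have hcard : 3 ≤ Fintype.card (Option (Fin m)) := by
    rw [Fintype.card_option, Fintype.card_fin]; omega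
  obtain ⟨T₀, hT₀⟩ := Filter.eventually_atTop.1 h
  refine eventually_dualSol_of_const hσ θ (by linarith) hδ'
    (Fintype.card (Option (Fin m)) * (4 + 1)) ?_
  filter_upwards [Filter.eventually_gt_atTop 1,
    (tendsto_rpow_atTop hη0).eventually_ge_atTop T₀] with s hs hsT
  have hs0 : 0 < s := by linarith
  have mono : ∀ {x y : ℝ}, x ≤ y → s ^ x ≤ s ^ y :=
    fun hxy => Real.rpow_le_rpow_of_exponent_le hs.le hxy
  have hint : ∀ z w : Option (Fin m) → ℤ,
      ∃ n : ℤ, primalPt θ z ⬝ᵥ (dualMatrix θ *ᵥ fun j => (w j : ℝ)) = n :=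
    fun z w => ⟨_, primalPt_dotProduct_dualPt θ z w⟩
  suffices hw : ∃ w : Option (Fin m) → ℤ, w ≠ 0 ∧ ∀ o,
      |(dualMatrix θ *ᵥ fun j => (w j : ℝ)) o|
        ≤ Fintype.card (Option (Fin m)) * (4 + 1) * s ^ dualExp σ δ o by
    obtain ⟨w, hw, hb⟩ := hw
    exact ⟨w, hw, by simpa [dualExp, dualPt] using hb none, fun j => hb (some j)⟩
  -- The box at scale `s ^ η`, where the hypothesis provides a point with linear form at most `s ^
  -- (-1)`.
  let Z : Set (Option (Fin m) → ℤ) :=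
    {z | z ≠ 0 ∧ ∀ j, |primalPt θ z (some j)| ≤ s ^ (η * σ j)}
  by_cases hsmall : ∃ z ∈ Z, |primalPt θ z none| ≤ s ^ (-δ)
  · obtain ⟨z, ⟨hz, hzj⟩, hz0⟩ := hsmall
    refine exists_int_in_rpow_box_of_form hcard (det_dualMatrix θ) _ (sum_dualExp hsum δ) hs0
      (by norm_num) (hint z) (primalPt_ne_zero θ hz) fun o => ?_
    suffices |primalPt θ z o| ≤ s ^ (1 - δ - dualExp σ δ o) by
      have := Real.rpow_nonneg hs0.le (1 - δ - dualExp σ δ o)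
      linarith
    cases o with
    | none => exact hz0.trans (mono (by simp [dualExp]))
    | some j => exact (hzj j).trans (mono (by simp only [dualExp, Option.elim]; linarith [key j]))
  push Not at hsmall
  have hpow : ∀ a b : ℝ, (s ^ a) ^ b = s ^ (a * b) := fun a b => (Real.rpow_mul hs0.le _ _).symm
  let V : Set ℝ := (fun z => |primalPt θ z none|) '' Z
  obtain ⟨z₀, hz₀, hz₀j, hz₀0⟩ := hT₀ _ hsT
  simp only [hpow] at hz₀j hz₀0
  have hz₀Z : z₀ ∈ Z := ⟨hz₀, hz₀j⟩
  have hVbdd : BddBelow V := ⟨0, by rintro _ ⟨z, -, rfl⟩; exact abs_nonneg _⟩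
  have hVne : V.Nonempty := ⟨_, z₀, hz₀Z, rfl⟩
  have hVle : s ^ (-δ) ≤ sInf V := le_csInf hVne (by rintro _ ⟨z, hz, rfl⟩; exact (hsmall z hz).le)
  have hVpos : 0 < sInf V := (Real.rpow_pos_of_pos hs0 _).trans_le hVle
  -- a point of `Z` which is almost minimal, and not worse than `z₀`
  obtain ⟨z₁, hz₁Z, hz₁min, hz₁le⟩ : ∃ z ∈ Z, |primalPt θ z none| < 2 * sInf V ∧
      |primalPt θ z none| ≤ s ^ (-1 : ℝ) := by
    by_cases hc : |primalPt θ z₀ none| < 2 * sInf V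
    · exact ⟨z₀, hz₀Z, hc, hz₀0.trans (mono (by nlinarith))⟩
    · obtain ⟨_, ⟨z, hz, rfl⟩, hlt⟩ :=
        exists_lt_of_csInf_lt hVne (show sInf V < 2 * sInf V by linarith)
      refine ⟨z, hz, hlt, ?_⟩
      exact ((hlt.le.trans (not_lt.1 hc)).trans hz₀0).trans (mono (by nlinarith))
  set l := |primalPt θ z₁ none| with hl
  have hl0 : 0 < l := hVpos.trans_le (csInf_le hVbdd ⟨z₁, hz₁Z, rfl⟩)
  -- `s ^ α` is the scale at which the hypothesis guarantees exactly the value `l`; doubling it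
  -- below gains the factor `2 ^ (-γ) ≤ 1 / 2`, enough to fall below the infimum and so to leave
  -- `Z`.
  obtain ⟨α, hα⟩ : ∃ α, s ^ (-(γ * α)) = l :=
    ⟨-(η * Real.logb s l), by
      rw [show -(γ * -(η * Real.logb s l)) = Real.logb s l by
        linear_combination Real.logb s l * hγη]
      exact Real.rpow_logb hs0 hs.ne' hl0⟩
  have hα1 : η ≤ α := by
    have : -(γ * α) ≤ -1 := (Real.rpow_le_rpow_left_iff hs).1 (hα.le.trans hz₁le)
    nlinarith
  have hα2 : γ * α < δ := by
    have := (Real.rpow_lt_rpow_left_iff hs).1 ((hsmall z₁ hz₁Z).trans_le hα.ge)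
    linarith
  obtain ⟨z₂, hz₂, hz₂j, hz₂0⟩ := hT₀ (2 * s ^ α)
    (by linarith [mono hα1, Real.rpow_pos_of_pos hs0 α])
  have hσ1 : ∀ j, σ j ≤ 1 := fun j =>
    hsum ▸ Finset.single_le_sum (fun i _ => (hσ i).le) (Finset.mem_univ j)
  replace hz₂j : ∀ j, |primalPt θ z₂ (some j)| ≤ 2 * s ^ (α * σ j) := fun j => by
    refine (hz₂j j).trans ?_
    rw [Real.mul_rpow (by norm_num) (Real.rpow_nonneg hs0.le _), hpow]
    have : (2 : ℝ) ^ σ j ≤ 2 ^ (1 : ℝ) :=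
      Real.rpow_le_rpow_of_exponent_le (by norm_num) (hσ1 j)
    rw [Real.rpow_one] at this
    gcongr
  replace hz₂0 : |primalPt θ z₂ none| ≤ l / 2 := by
    refine hz₂0.trans ?_
    rw [Real.mul_rpow (by norm_num) (Real.rpow_nonneg hs0.le _), hpow, ← hα]
    have : (2 : ℝ) ^ (-γ) ≤ 2 ^ (-1 : ℝ) :=
      Real.rpow_le_rpow_of_exponent_le (by norm_num) (by linarith)
    rw [Real.rpow_neg_one] at this
    rw [show α * -γ = -(γ * α) by ring, div_eq_inv_mul]
    gcongr
  have hz₂Z : z₂ ∉ Z := fun hz => by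
    have := csInf_le hVbdd ⟨z₂, hz, rfl⟩
    linarith
  obtain ⟨k, hk⟩ : ∃ k, s ^ (η * σ k) < |primalPt θ z₂ (some k)| := by
    by_contra! hc
    exact hz₂Z ⟨hz₂, hc⟩
  refine exists_int_in_rpow_box_of_pair hcard (det_dualMatrix θ) _ (sum_dualExp hsum δ) hs0
    (by norm_num) (hint z₁) (hint z₂) ⟨none, some k, ?_⟩
    (forall_option_pair minor_bound_symm (fun j => ?_) (fun i j _ => ?_))
  · exact minor_ne_zero_of_abs_lt (by linarith) ((hz₁Z.2 k).trans_lt hk) (abs_pos.1 hl0)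
  · refine (abs_minor_le hl.symm.le (hz₁Z.2 j) hz₂0 (hz₂j j)).trans ?_
    have h1 : s ^ (η * σ j) ≤ s ^ (α * σ j) := mono (mul_le_mul_of_nonneg_right hα1 (hσ j).le)
    have h2 : l * s ^ (α * σ j) ≤ s ^ (1 - δ - dualExp σ δ none - dualExp σ δ (some j)) := by
      rw [← hα, ← Real.rpow_add hs0]
      refine mono ?_
      simp only [dualExp, Option.elim]
      -- As `γ ≥ σ j`, the exponent `-α * (γ - σ j)` is largest at `α = η`, where it equals `-1 + η
      -- * σ j` and `key j` applies.
      nlinarith [key j, mul_nonneg (sub_nonneg.2 hα1) (sub_nonneg.2 ((hσ1 j).trans hγ))]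
    have h3 : s ^ (η * σ j) * (l / 2) ≤ s ^ (α * σ j) * l := by
      have := Real.rpow_pos_of_pos hs0 (α * σ j)
      gcongr
      linarith
    have := Real.rpow_nonneg hs0.le (1 - δ - dualExp σ δ none - dualExp σ δ (some j))
    linarith
  · have h1 : ∀ i j, s ^ (η * σ i) * s ^ (α * σ j)
        ≤ s ^ (1 - δ - dualExp σ δ (some i) - dualExp σ δ (some j)) := fun i j => by
      rw [← Real.rpow_add hs0]
      refine mono ?_
      simp only [dualExp, Option.elim]
      have : α ≤ δ := by nlinarith
      nlinarith [key i, mul_le_mul_of_nonneg_right this (hσ j).le]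
    have h2 := h1 j i
    rw [sub_right_comm] at h2
    refine (abs_minor_le (hz₁Z.2 i) (hz₁Z.2 j) (hz₂j i) (hz₂j j)).trans ?_
    linarith [h1 i j]

theorem eventually_primalSol_of_dualSol {m : ℕ} (hm : 2 ≤ m) {σ : Fin m → ℝ}
    (hσ : ∀ j, 0 < σ j) (hsum : ∑ j, σ j = 1) {σm : ℝ} (hσm : ∀ j, σm ≤ σ j)
    (θ : Fin m → ℝ) {γ γ' δ : ℝ} (hγ : 1 ≤ γ) (hδ : 1 ≤ δ) (hγδ : γ * (1 - σm * δ) ≤ 1 - σm)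
    (hγ' : γ' < γ) (h : ∀ᶠ t : ℝ in Filter.atTop, DualSol σ θ δ t) :
    ∀ᶠ t : ℝ in Filter.atTop, PrimalSol σ θ γ' t := by
  have hcard : 3 ≤ Fintype.card (Option (Fin m)) := by
    rw [Fintype.card_option, Fintype.card_fin]; omega
  have hσ1 : ∀ j, σ j ≤ 1 := fun j =>
    hsum ▸ Finset.single_le_sum (fun i _ => (hσ i).le) (Finset.mem_univ j)
  have hγδ1 : 1 ≤ γ * δ := by nlinarith
  -- Equivalent to `γ - 1 ≤ σ j * (γ * δ - 1)`; since `γ * δ ≥ 1`, the least weight is again the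
  -- worst case.
  have key : ∀ j, γ * (1 - δ * σ j) ≤ 1 - σ j := fun j => by nlinarith [hσm j]
  obtain ⟨T₀, hT₀⟩ := Filter.eventually_atTop.1 h
  set K : ℝ := 2 ^ δ with hK
  have hK1 : 1 ≤ K := Real.one_le_rpow (by norm_num) (by linarith)
  refine eventually_primalSol_of_const hσ θ (by linarith) hγ'
    (Fintype.card (Option (Fin m)) * (2 * K + 1)) ?_
  filter_upwards [Filter.eventually_gt_atTop 1, Filter.eventually_ge_atTop (2 * T₀),
    Filter.eventually_ge_atTop T₀] with s hs hsT hsT'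
  have hs0 : 0 < s := by linarith
  have mono : ∀ {x y : ℝ}, x ≤ y → s ^ x ≤ s ^ y :=
    fun hxy => Real.rpow_le_rpow_of_exponent_le hs.le hxy
  have hpow : ∀ a b : ℝ, (s ^ a) ^ b = s ^ (a * b) := fun a b => (Real.rpow_mul hs0.le _ _).symm
  have hint : ∀ w z : Option (Fin m) → ℤ,
      ∃ n : ℤ, dualPt θ w ⬝ᵥ (primalMatrix θ *ᵥ fun j => (z j : ℝ)) = n :=
    fun w z => ⟨_, by rw [dotProduct_comm]; exact primalPt_dotProduct_dualPt θ z w⟩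
  suffices hz : ∃ z : Option (Fin m) → ℤ, z ≠ 0 ∧ ∀ o,
      |(primalMatrix θ *ᵥ fun j => (z j : ℝ)) o|
        ≤ Fintype.card (Option (Fin m)) * (2 * K + 1) * s ^ primalExp σ γ o by
    obtain ⟨z, hz, hb⟩ := hz
    exact ⟨z, hz, fun j => hb (some j), hb none⟩
  -- The box of the hypothesis at scale `s ^ γ`, with the bound on the first coordinate dropped.
  let W : Set (Option (Fin m) → ℤ) :=
    {w | w ≠ 0 ∧ ∀ j, |dualPt θ w (some j)| ≤ s ^ (-(γ * δ * σ j))}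
  obtain ⟨w₀, hw₀, hw₀0, hw₀j⟩ := hT₀ (s ^ γ)
    (hsT'.trans (by simpa using mono hγ))
  have hw₀W : w₀ ∈ W := ⟨hw₀, fun j => (hw₀j j).trans_eq (by rw [hpow]; congr 1; ring)⟩
  -- the point of `W` with the least first coordinate
  obtain ⟨w₂, hw₂W, hw₂min⟩ : ∃ w ∈ W, ∀ w' ∈ W, |dualPt θ w none| ≤ |dualPt θ w' none| := by
    obtain ⟨w, hw, hmin⟩ :=
      (measure fun w : Option (Fin m) → ℤ => (w none).natAbs).wf.has_min W ⟨w₀, hw₀W⟩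
    refine ⟨w, hw, fun w' hw' => ?_⟩
    have := hmin w' hw'
    simp only [InvImage, WellFoundedRelation.rel, not_lt] at this
    rw [dualPt_none, dualPt_none]
    have h' : |w none| ≤ |w' none| := by
      rw [Int.abs_eq_natAbs, Int.abs_eq_natAbs]
      exact_mod_cast this
    exact_mod_cast h'
  set q := |dualPt θ w₂ none| with hq
  have hqγ : q ≤ s ^ γ := (hw₂min w₀ hw₀W).trans hw₀0
  by_cases hqs : q ≤ s
  · refine exists_int_in_rpow_box_of_form hcard (det_primalMatrix θ) _ (sum_primalExp hsum γ) hs0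
      (by linarith) (hint w₂) (dualPt_ne_zero θ hw₂W.1) fun o => ?_
    suffices |dualPt θ w₂ o| ≤ s ^ (1 - γ - primalExp σ γ o) by
      have := Real.rpow_nonneg hs0.le (1 - γ - primalExp σ γ o)
      nlinarith
    cases o with
    | none => exact (hqs.trans_eq (Real.rpow_one s).symm).trans (mono (by simp [primalExp]))
    | some j =>
      exact (hw₂W.2 j).trans (mono (by simp only [primalExp, Option.elim]; nlinarith [key j]))
  push Not at hqs
  obtain ⟨α, hα⟩ : ∃ α, s ^ α = q := ⟨Real.logb s q, Real.rpow_logb hs0 hs.ne' (by linarith)⟩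
  have hα1 : 1 ≤ α := (Real.rpow_le_rpow_left_iff hs).1 (by simpa [hα] using hqs.le)
  have hα2 : α ≤ γ := (Real.rpow_le_rpow_left_iff hs).1 (by simpa [hα] using hqγ)
  -- At scale `q / 2` the first coordinate beats the minimum `q`, so `w₁` lies outside `W`; halving
  -- the scale costs at most the factor `K = 2 ^ δ` in the other coordinates.
  obtain ⟨w₁, hw₁, hw₁0, hw₁j⟩ := hT₀ (q / 2) (by linarith)
  replace hw₁j : ∀ j, |dualPt θ w₁ (some j)| ≤ K * s ^ (-(α * δ * σ j)) := fun j => by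
    refine (hw₁j j).trans ?_
    rw [Real.div_rpow (by linarith) (by norm_num), ← hα, hpow, div_eq_mul_inv,
      ← Real.rpow_neg (by norm_num), neg_neg, mul_comm,
      show α * -(δ * σ j) = -(α * δ * σ j) by ring]
    have : (2 : ℝ) ^ (δ * σ j) ≤ K :=
      Real.rpow_le_rpow_of_exponent_le (by norm_num) (by nlinarith [hσ1 j])
    gcongr
  have hw₁W : w₁ ∉ W := fun hw => by
    have := hw₂min w₁ hw
    linarith
  obtain ⟨k, hk⟩ : ∃ k, s ^ (-(γ * δ * σ k)) < |dualPt θ w₁ (some k)| := by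
    by_contra! hc
    exact hw₁W ⟨hw₁, hc⟩
  refine exists_int_in_rpow_box_of_pair hcard (det_primalMatrix θ) _ (sum_primalExp hsum γ) hs0
    (by linarith) (hint w₂) (hint w₁) ⟨none, some k, ?_⟩
    (forall_option_pair minor_bound_symm (fun j => ?_) (fun i j _ => ?_))
  · exact minor_ne_zero_of_abs_lt (by linarith) ((hw₂W.2 k).trans_lt hk) (abs_pos.1 (by linarith))
  · refine (abs_minor_le hq.symm.le (hw₂W.2 j) hw₁0 (hw₁j j)).trans ?_
    have h1 : q * s ^ (-(α * δ * σ j))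
        ≤ s ^ (1 - γ - primalExp σ γ none - primalExp σ γ (some j)) := by
      rw [← hα, ← Real.rpow_add hs0]
      refine mono ?_
      simp only [primalExp, Option.elim]
      -- The exponent is `α * (1 - δ * σ j)`: for a nonnegative factor `α ≤ γ` and `key j` bound it
      -- by `1 - σ j`, otherwise it is nonpositive.
      rcases le_total 0 (1 - δ * σ j) with h0 | h0
      · nlinarith [key j, mul_le_mul_of_nonneg_right hα2 h0]
      · nlinarith [hσ1 j]
    have h2 : s ^ (-(γ * δ * σ j)) * (q / 2) ≤ s ^ (-(α * δ * σ j)) * q := by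
      have : s ^ (-(γ * δ * σ j)) ≤ s ^ (-(α * δ * σ j)) := mono (by
        have := mul_le_mul_of_nonneg_right hα2 (mul_nonneg (by linarith : 0 ≤ δ) (hσ j).le)
        linarith)
      have := Real.rpow_pos_of_pos hs0 (-(α * δ * σ j))
      gcongr
      linarith
    have h3 := mul_le_mul_of_nonneg_left h1 (by linarith : 0 ≤ K)
    have := Real.rpow_nonneg hs0.le (1 - γ - primalExp σ γ none - primalExp σ γ (some j))
    nlinarith
  · have h1 : ∀ i j, s ^ (-(γ * δ * σ i)) * (s ^ (-(α * δ * σ j)))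
        ≤ s ^ (1 - γ - primalExp σ γ (some i) - primalExp σ γ (some j)) := fun i j => by
      rw [← Real.rpow_add hs0]
      refine mono ?_
      simp only [primalExp, Option.elim]
      have : 1 * σ j ≤ α * δ * σ j := mul_le_mul_of_nonneg_right (by nlinarith) (hσ j).le
      nlinarith [key i]
    have h2 := h1 j i
    rw [sub_right_comm] at h2
    refine (abs_minor_le (hw₂W.2 i) (hw₂W.2 j) (hw₁j i) (hw₁j j)).trans ?_
    nlinarith [h1 i j]

/-! ### The bound coming from an irrational coordinate. -/

theorem mul_le_one_of_dualSol {m : ℕ} {σ : Fin m → ℝ} (hσ : ∀ j, 0 < σ j) {θ : Fin m → ℝ}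
    {δ : ℝ} (hδ : 0 < δ) (h : ∀ᶠ t : ℝ in Filter.atTop, DualSol σ θ δ t) {k : Fin m}
    (hk : Irrational (θ k)) : σ k * δ ≤ 1 := by
  by_contra! hc
  set c := δ * σ k with hcdef
  have hc1 : 1 < c := by rw [hcdef, mul_comm]; exact hc
  -- at every large scale, an integer approximation of `θ k` with nonzero denominator
  have happ : ∀ᶠ t : ℝ in Filter.atTop, ∃ q p : ℤ, q ≠ 0 ∧ |(q : ℝ)| ≤ t ∧
      |(p : ℝ) - θ k * q| ≤ t ^ (-c) := by
    filter_upwards [h, Filter.eventually_gt_atTop 1] with t ⟨w, hw, h0, hj⟩ ht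
    -- If the denominator vanished, every other coordinate would be an integer of modulus below 1,
    -- making `w` zero.
    refine ⟨w none, w (some k), fun hq => hw ?_, by simpa using h0, by simpa using hj k⟩
    ext o
    cases o with
    | none => exact hq
    | some j =>
      have h1 := (hj j).trans_lt (Real.rpow_lt_one_of_one_lt_of_neg ht
        (neg_lt_zero.2 (mul_pos hδ (hσ j))))
      rw [dualPt_some, hq, Int.cast_zero, mul_zero, sub_zero] at h1
      have h2 : |w (some j)| < 1 := by exact_mod_cast h1
      exact Int.abs_lt_one_iff.1 h2
  -- The constant 3 is `1 + 2`: the cross determinant of approximations at scales `t` and `2 * t` is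
  -- at most `t ^ (-c) * t + t ^ (-c) * (2 * t)`.
  have hsmall : ∀ᶠ t : ℝ in Filter.atTop, 3 * t ^ (1 - c) ≤ t ^ (-((c - 1) / 2)) :=
    eventually_const_mul_rpow_le 3 (by linarith)
  obtain ⟨T, hT⟩ := Filter.eventually_atTop.1
    ((happ.and hsmall).and (Filter.eventually_gt_atTop 1))
  have hT' : ∀ n : ℕ, T ≤ 2 ^ n * max T 2 := fun n =>
    (le_max_left T 2).trans (le_mul_of_one_le_left (by positivity) (one_le_pow₀ (by norm_num)))
  choose q p hq hqle hp using fun n : ℕ => (hT _ (hT' n)).1.1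
  set t : ℕ → ℝ := fun n => 2 ^ n * max T 2 with ht
  have ht1 : ∀ n, 1 < t n := fun n => (hT _ (hT' n)).2
  have hstep : ∀ n, p (n + 1) * q n = p n * q (n + 1) := by
    intro n
    have ht0 : 0 < t n := by linarith [ht1 n]
    have hsucc : t (n + 1) = 2 * t n := by simp only [ht]; ring
    have h1 : |(p (n + 1) : ℝ) - θ k * q (n + 1)| ≤ t n ^ (-c) :=
      (hp (n + 1)).trans (Real.rpow_le_rpow_of_nonpos ht0 (by
        change t n ≤ t (n + 1)
        linarith) (by linarith))
    have h2 : |(q (n + 1) : ℝ)| ≤ 2 * t n := (hqle (n + 1)).trans_eq hsucc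
    have h3 := abs_minor_le h1 (hp n) h2 (hqle n)
    have h4 : t n ^ (-c) * t n = t n ^ (1 - c) := by
      nth_rw 2 [← Real.rpow_one (t n)]
      rw [← Real.rpow_add ht0]; congr 1; ring
    have h5 : t n ^ (-((c - 1) / 2)) < 1 :=
      Real.rpow_lt_one_of_one_lt_of_neg (ht1 n) (by linarith)
    have h6 : 3 * t n ^ (1 - c) ≤ t n ^ (-((c - 1) / 2)) := (hT _ (hT' n)).1.2
    have h7 : |((p (n + 1) * q n - p n * q (n + 1) : ℤ) : ℝ)| < 1 := by
      push_cast
      rw [show (p (n + 1) * q n - p n * q (n + 1) : ℝ) =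
        (p (n + 1) - θ k * q (n + 1)) * q n - (p n - θ k * q n) * q (n + 1) by ring]
      change _ ≤ t n ^ (-c) * t n + t n ^ (-c) * (2 * t n) at h3
      linarith
    have h8 : |p (n + 1) * q n - p n * q (n + 1)| < 1 := by exact_mod_cast h7
    exact sub_eq_zero.1 (Int.abs_lt_one_iff.1 h8)
  have hq' : ∀ n, (q n : ℝ) ≠ 0 := fun n => by exact_mod_cast hq n
  have hratio : ∀ n, (p n : ℝ) / q n = p 0 / q 0 := by
    intro n
    induction n with
    | zero => rfl
    | succ n ih =>
      rw [← ih, div_eq_div_iff (hq' _) (hq' _)]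
      exact_mod_cast hstep n
  have hbound : ∀ n, |(p 0 : ℝ) / q 0 - θ k| ≤ t n ^ (-c) := fun n => by
    refine le_trans ?_ (hp n)
    have h1 : (1 : ℝ) ≤ |(q n : ℝ)| := by
      exact_mod_cast Int.one_le_abs (hq n)
    rw [← hratio n, show (p n : ℝ) - θ k * q n = (p n / q n - θ k) * q n by
      field_simp [hq' n], abs_mul]
    exact le_mul_of_one_le_right (abs_nonneg _) h1
  have htop : Filter.Tendsto t Filter.atTop Filter.atTop :=
    (tendsto_pow_atTop_atTop_of_one_lt (by norm_num)).atTop_mul_const (by positivity)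
  have hlim := (tendsto_rpow_neg_atTop (by linarith : 0 < c)).comp htop
  have h0 := ge_of_tendsto' hlim hbound
  have heq : θ k = p 0 / q 0 := by
    have := abs_eq_zero.1 (le_antisymm h0 (abs_nonneg _))
    linarith
  exact hk ⟨(p 0 : ℚ) / q 0, by rw [heq]; push_cast; rfl⟩

/-! ### From individual exponents to their suprema. -/

theorem isLUB_coe_sSup {A : Set ℝ} {x : ℝ}
    (h : sSup ((fun γ : ℝ => (γ : EReal)) '' A) = x) : IsLUB A x := by
  have hl := isLUB_sSup ((fun γ : ℝ => (γ : EReal)) '' A)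
  rw [h] at hl
  refine ⟨fun a ha => EReal.coe_le_coe_iff.1 (hl.1 ⟨a, ha, rfl⟩), fun u hu => ?_⟩
  refine EReal.coe_le_coe_iff.1 (hl.2 ?_)
  rintro _ ⟨a, ha, rfl⟩
  exact EReal.coe_le_coe_iff.2 (hu ha)

theorem le_of_forall_lt_mem {A : Set ℝ} {a : ℝ} (hA : ∀ γ < a, γ ∈ A) {x : ℝ}
    (hx : IsLUB A x) : a ≤ x :=
  le_of_forall_lt fun _ hc =>
    let ⟨_, h1, h2⟩ := exists_between hc
    h1.trans_le (hx.1 (hA _ h2))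

theorem sSup_coe_ne_bot {A : Set ℝ} (hA : A.Nonempty) :
    sSup ((fun γ : ℝ => (γ : EReal)) '' A) ≠ ⊥ := by
  obtain ⟨a, ha⟩ := hA
  exact ((EReal.bot_lt_coe a).trans_le (le_sSup (Set.mem_image_of_mem _ ha))).ne'

theorem sSup_coe_le {A : Set ℝ} {u : ℝ} (hu : ∀ a ∈ A, a ≤ u) :
    sSup ((fun γ : ℝ => (γ : EReal)) '' A) ≤ u := by
  refine sSup_le ?_
  rintro _ ⟨a, ha, rfl⟩
  exact EReal.coe_le_coe_iff.2 (hu a ha)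

/-- Passage from transference between individual exponents to transference between suprema. -/
theorem transference_sSup {A B : Set ℝ} {s : ℝ} (hs0 : 0 < s) (hs1 : s < 1)
    (hA : ∀ γ < 1, γ ∈ A) (hB : ∀ δ < 1, δ ∈ B) (hbdd : ∀ δ ∈ B, s * δ ≤ 1)
    (hAB : ∀ γ ∈ A, 1 ≤ γ → ∀ δ, δ * (1 - s) = 1 - s * γ⁻¹ → ∀ δ' < δ, δ' ∈ B)
    (hBA : ∀ δ ∈ B, 1 ≤ δ → ∀ γ, 1 ≤ γ → γ * (1 - s * δ) ≤ 1 - s → ∀ γ' < γ, γ' ∈ A)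
    {ω ωt : EReal} (hω : ω = sSup ((fun γ : ℝ => (γ : EReal)) '' A))
    (hωt : ωt = sSup ((fun γ : ℝ => (γ : EReal)) '' B)) :
    1 ≤ ((1 - s : ℝ) : EReal) * ωt + (s : EReal) * ω⁻¹ ∧
    (s : EReal) * ωt + ((1 - s : ℝ) : EReal) * ω⁻¹ ≤ 1 := by
  have hωtop : ωt ≠ ⊤ := by
    rw [hωt]
    exact ((sSup_coe_le (u := 1 / s) fun δ hδ => by
      rw [le_div_iff₀ hs0, mul_comm]; exact hbdd δ hδ).trans_lt (EReal.coe_lt_top _)).ne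
  have hωbot : ωt ≠ ⊥ := hωt ▸ sSup_coe_ne_bot ⟨0, hB 0 one_pos⟩
  lift ωt to ℝ using ⟨hωtop, hωbot⟩
  have hd := isLUB_coe_sSup hωt.symm
  have hd1 := le_of_forall_lt_mem hB hd
  have hsd : s * ωt ≤ 1 := by
    have : ωt ≤ 1 / s := hd.2 fun δ hδ => by
      rw [le_div_iff₀ hs0, mul_comm]; exact hbdd δ hδ
    rwa [le_div_iff₀ hs0, mul_comm] at this
  have hAd : ∀ γ ∈ A, 1 ≤ γ → 1 - (1 - s) * ωt ≤ s * γ⁻¹ := by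
    intro γ hγ h1
    have hs : (1 - s) ≠ 0 := by linarith
    have := le_of_forall_lt_mem
      (hAB γ hγ h1 ((1 - s * γ⁻¹) / (1 - s)) (div_mul_cancel₀ _ hs)) hd
    rw [div_le_iff₀ (by linarith)] at this
    linarith
  -- If the first inequality failed even with `ω⁻¹ = 0`, `A` would be bounded; this settles `ω = ⊤`
  -- and also yields the finite case.
  have hAle : 0 < 1 - (1 - s) * ωt → ∀ γ ∈ A, γ ≤ s / (1 - (1 - s) * ωt) := by
    intro hc γ hγ
    rw [le_div_iff₀ hc]
    rcases lt_or_ge γ 1 with h | h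
    · nlinarith
    · have := mul_le_mul_of_nonneg_left (hAd γ hγ h) (by linarith : 0 ≤ γ)
      rwa [mul_left_comm, mul_inv_cancel₀ (by linarith), mul_one] at this
  induction ω using EReal.rec with
  | bot => exact absurd hω.symm (sSup_coe_ne_bot ⟨0, hA 0 one_pos⟩)
  | top =>
    rw [EReal.inv_top, mul_zero, mul_zero, add_zero, add_zero]
    refine ⟨?_, by exact_mod_cast hsd⟩
    have : 1 - (1 - s) * ωt ≤ 0 := by
      by_contra! hc
      exact absurd (hω.trans_le (sSup_coe_le (hAle hc))) (not_le.2 (EReal.coe_lt_top _))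
    exact_mod_cast (by linarith : 1 ≤ (1 - s) * ωt)
  | coe w =>
    have hw := isLUB_coe_sSup hω.symm
    have hw1 := le_of_forall_lt_mem hA hw
    have hw0 : 0 < w := by linarith
    rw [← EReal.coe_inv]
    have hinv : 0 < w⁻¹ := inv_pos.2 hw0
    have hinv1 : w⁻¹ ≤ 1 := inv_le_one_of_one_le₀ hw1
    have first : 1 ≤ (1 - s) * ωt + s * w⁻¹ := by
      rcases le_or_gt (1 - (1 - s) * ωt) 0 with hc | hc
      · nlinarith
      · have h1 : w ≤ s / (1 - (1 - s) * ωt) := hw.2 (hAle hc)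
        rw [le_div_iff₀ hc] at h1
        have h2 := mul_le_mul_of_nonneg_right h1 hinv.le
        rw [mul_right_comm, mul_inv_cancel₀ hw0.ne', one_mul] at h2
        linarith
    have second : s * ωt + (1 - s) * w⁻¹ ≤ 1 := by
      suffices h : ωt ≤ (1 - (1 - s) * w⁻¹) / s by
        rw [le_div_iff₀ hs0] at h
        linarith
      refine hd.2 fun δ hδ => ?_
      rw [le_div_iff₀ hs0]
      rcases lt_or_ge δ 1 with h | h
      · nlinarith
      · by_contra! hc
        -- A violation of the second inequality by some `δ ∈ B` would transfer to an exponent `γ >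
        -- w`, contradicting that `w` is the supremum of `A`. When `1 - s * δ ≤ 0` the condition on
        -- `γ` holds for any `γ ≥ 0`, so `w + 1` serves.
        obtain ⟨γ, hwγ, hγ⟩ : ∃ γ, w < γ ∧ γ * (1 - s * δ) ≤ 1 - s := by
          rcases le_or_gt (1 - s * δ) 0 with h0 | h0
          · exact ⟨w + 1, by linarith, by nlinarith⟩
          · refine ⟨(1 - s) / (1 - s * δ), ?_, (div_mul_cancel₀ _ h0.ne').le⟩
            rw [lt_div_iff₀ h0]
            have h1 : 1 - s * δ < (1 - s) * w⁻¹ := by linarith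
            have h2 := mul_lt_mul_of_pos_left h1 hw0
            rwa [mul_left_comm, mul_inv_cancel₀ hw0.ne', mul_one] at h2
        have := le_of_forall_lt_mem (hBA δ hδ h γ (by linarith) hγ) hw
        linarith
    exact ⟨by exact_mod_cast first, by exact_mod_cast second⟩

theorem setOf_uniform_eq {P Q : ℝ → ℝ → Prop} (h : ∀ γ t, 0 < t → (P γ t ↔ Q γ t)) :
    {γ : ℝ | ∃ T : ℝ, ∀ t : ℝ, T ≤ t → P γ t} = {γ | ∀ᶠ t : ℝ in Filter.atTop, Q γ t} := by
  ext γ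
  rw [Set.mem_ofPred_eq, Set.mem_ofPred_eq, ← Filter.eventually_atTop]
  refine Filter.eventually_congr ?_
  filter_upwards [Filter.eventually_gt_atTop 0] with t ht using h γ t ht

theorem exists_isLeast_irrational {m : ℕ} {Θ : Matrix (Fin 1) (Fin m) ℝ}
    (hΘ : ¬ ∃ A : Matrix (Fin 1) (Fin m) ℚ, Θ = A.map (fun q => (q : ℝ))) :
    ∃ k : Fin m, IsLeast {j : Fin m | Irrational (Θ 0 j)} k := by
  have hne : {j : Fin m | Irrational (Θ 0 j)}.Nonempty := by
    by_contra! hc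
    have : ∀ j, ∃ q : ℚ, (q : ℝ) = Θ 0 j := fun j => by
      have : j ∉ {j : Fin m | Irrational (Θ 0 j)} := by simp [hc]
      simpa [Irrational] using this
    choose q hq using this
    refine hΘ ⟨Matrix.of fun _ j => q j, ?_⟩
    ext i j
    rw [Subsingleton.elim i 0]
    exact (hq j).symm
  exact ⟨_, WellFounded.min_mem wellFounded_lt _ hne,
    fun j hj => not_lt.1 (WellFounded.not_lt_min wellFounded_lt _ hj)⟩

theorem theoremt (m : ℕ) (hm : 2 ≤ m)
    (σ : Fin m → ℝ) (hσ_pos : ∀ j, 0 < σ j) (hσ_anti : Antitone σ) (hσ_sum : ∑ j, σ j = 1)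
    (ρ : Fin 1 → ℝ) (hρ_pos : ∀ i, 0 < ρ i) (hρ_sum : ∑ i, ρ i = 1)
    (Θ : Matrix (Fin 1) (Fin m) ℝ)
    (hΘ : ¬ ∃ A : Matrix (Fin 1) (Fin m) ℚ, Θ = A.map (fun q => (q : ℝ)))
    (σm : ℝ) (hσm : σm = σ ⟨m - 1, by omega⟩)
    (ω ωt : EReal) (hω : ω = uniformExponent σ ρ Θ) (hωt : ωt = uniformExponent ρ σ Θᵀ) :
    1 ≤ ((1 - σm : ℝ) : EReal) * ωt + (σm : EReal) * ω⁻¹ ∧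
    (σm : EReal) * ωt + ((1 - σm : ℝ) : EReal) * ω⁻¹ ≤ 1 ∧
    ∃ k : Fin m, IsLeast {j : Fin m | Irrational (Θ 0 j)} k ∧ (σ k : EReal) * ωt ≤ 1 := by
  have hm0 : 0 < m := by omega
  have hρ : ρ 0 = 1 := by simpa using hρ_sum
  rw [uniformExponent, setOf_uniform_eq fun γ t ht =>
    hasNonzeroSolution_iff_primalSol hm0 hσ_pos hρ Θ γ ht] at hω
  rw [uniformExponent, setOf_uniform_eq fun δ t ht =>
    hasNonzeroSolution_iff_dualSol hm0 hσ_pos hρ Θ δ ht] at hωt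
  have hmin : ∀ j, σm ≤ σ j := fun j => hσm ▸ hσ_anti (Fin.mk_le_mk.2 (by omega))
  have hσm0 : 0 < σm := hσm ▸ hσ_pos _
  have hσm1 : σm < 1 := by
    have h01 : (⟨0, by omega⟩ : Fin m) ≠ ⟨1, by omega⟩ := by simp
    have h1 := Finset.sum_le_sum_of_subset_of_nonneg (f := σ)
      (Finset.subset_univ {(⟨0, by omega⟩ : Fin m), ⟨1, by omega⟩}) fun i _ _ => (hσ_pos i).le
    rw [Finset.sum_pair h01, hσ_sum] at h1
    linarith [hmin ⟨0, by omega⟩, hσ_pos ⟨1, by omega⟩]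
  obtain ⟨k, hk⟩ := exists_isLeast_irrational hΘ
  have hthird : ∀ δ ∈ {δ : ℝ | ∀ᶠ t : ℝ in Filter.atTop, DualSol σ (Θ 0) δ t}, σ k * δ ≤ 1 := by
    intro δ hδ
    rcases le_or_gt δ 0 with h | h
    · nlinarith [hσ_pos k]
    · exact mul_le_one_of_dualSol hσ_pos h hδ hk.1
  obtain ⟨h1, h2⟩ := transference_sSup hσm0 hσm1
    (fun γ hγ => eventually_primalSol_of_lt_one hσ_pos hσ_sum (Θ 0) hγ)
    (fun δ hδ => eventually_dualSol_of_lt_one hσ_pos hσ_sum (Θ 0) hδ)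
    (fun δ hδ => by
      rcases le_or_gt δ 0 with h | h
      · nlinarith
      · exact (mul_le_mul_of_nonneg_right (hmin k) h.le).trans (hthird δ hδ))
    (fun γ hγ h1 δ hδ δ' hlt => eventually_dualSol_of_primalSol hm hσ_pos hσ_sum hmin hσm1 (Θ 0)
      h1 hδ hlt hσm0 hγ)
    (fun δ hδ h1 γ hγ hγδ γ' hlt => eventually_primalSol_of_dualSol hm hσ_pos hσ_sum hmin (Θ 0)
      hγ h1 hγδ hlt hδ) hω hωt
  refine ⟨h1, h2, k, hk, ?_⟩
  have h3 : ωt ≤ ((σ k)⁻¹ : ℝ) := hωt ▸ sSup_coe_le fun δ hδ => by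
    rw [← one_div, le_div_iff₀ (hσ_pos k), mul_comm]
    exact hthird δ hδ
  calc (σ k : EReal) * ωt ≤ (σ k : EReal) * ((σ k)⁻¹ : ℝ) :=
        mul_le_mul_of_nonneg_left h3 (EReal.coe_nonneg.2 (hσ_pos k).le)
    _ = 1 := by
        rw [← EReal.coe_mul, mul_inv_cancel₀ (hσ_pos k).ne', EReal.coe_one]
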